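/- Graphs are finite and simple. For disjoint graphs $G_1,G_2$ and a bijection $f:V(G_1)\to V(G_2)$, let $G_1\oplus_f G_2$ be the graph obtained from their union by adding the edges $vf(v)$, $v\in V(G_1)$. The $n$-dimensional hypercube-like networks are defined recursively (up to isomorphism): $K_2$ is the only one of dimension $1$, and for $n\ge 2$ they are the graphs $G_1\oplus_f G_2$ where $G_1,G_2$ are $(n-1)$-dimensional hypercube-like networks and $f$ is any bijection between their vertex sets. A graph $G$ is *strongly Menger edge connected* if it is connected and, for any two distinct vertices $x,y$, there are $\min\{\deg_G(x),\deg_G(y)\}$ pairwise edge-disjoint $(x,y)$-paths in $G$. For a positive integer $m$, a connected graph $G$ is *$m$-conditional edge-fault-tolerant strongly Menger edge connected* if $G-T$ is strongly Menger edge connected for every $T\subseteq E(G)$ with $|T|\le m$ and minimum degree $\delta(G-T)\ge 2$. **Theorem.** Let $n\ge 4$ and let $L_n$ be the line graph of an $n$-dimensional hypercube-like network. Then $L_n$ is $(4n-10)$-conditional edge-fault-tolerant strongly Menger edge connected. This is sharp: there is a set $T\subseteq E(L_n)$ with $|T|=4n-9$ and $\delta(L_n-T)\ge 2$ such that $L_n-T$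 is not strongly Menger edge connected; consequently, for every integer $k>4n-10$, $L_n$ is not $k$-conditional edge-fault-tolerant strongly Menger edge connected. -/

import Mathlib

universe u v

/-- `G₁ ⊕_f G₂`: the disjoint union of `G₁` and `G₂` together with the edges joining
`v` and `f v`, for all vertices `v` of `G₁`. -/
def matchingJoin {V₁ : Type u} {V₂ : Type v} (G₁ : SimpleGraph V₁) (G₂ : SimpleGraph V₂)
    (f : V₁ ≃ V₂) : SimpleGraph (V₁ ⊕ V₂) where
  Adj
    | .inl a, .inl b => G₁.Adj a b
    | .inr a, .inr b => G₂.Adj a b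
    | .inl a, .inr b => f a = b
    | .inr a, .inl b => f b = a
  symm := ⟨by
    rintro (a | a) (b | b) h
    · exact SimpleGraph.Adj.symm h
    · exact h
    · exact h
    · exact SimpleGraph.Adj.symm h⟩
  loopless := ⟨by
    rintro (a | a) h
    · exact G₁.loopless.irrefl a h
    · exact G₂.loopless.irrefl a h⟩

/-- `IsHypercubeLike n G`: the graph `G` is (isomorphic to) an `n`-dimensional hypercube-like
network. `K₂` is the only one of dimension `1`, and those of dimension `n + 1` are the graphs
`G₁ ⊕_f G₂` with `G₁`, `G₂` of dimension `n` and `f` an arbitrary bijection. -/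
inductive IsHypercubeLike : ℕ → {V : Type u} → SimpleGraph V → Prop
  | one {V : Type u} {G : SimpleGraph V} (e : G ≃g (⊤ : SimpleGraph (Fin 2))) :
      IsHypercubeLike 1 G
  | step {n : ℕ} {V₁ V₂ V : Type u} {G₁ : SimpleGraph V₁} {G₂ : SimpleGraph V₂}
      {G : SimpleGraph V} (h₁ : IsHypercubeLike n G₁) (h₂ : IsHypercubeLike n G₂)
      (f : V₁ ≃ V₂) (e : G ≃g matchingJoin G₁ G₂ f) :
      IsHypercubeLike (n + 1) G

/-- There are `k` pairwise edge-disjoint paths from `x` to `y` in `G`. -/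
def HasEdgeDisjointPaths {V : Type u} (G : SimpleGraph V) (x y : V) (k : ℕ) : Prop :=
  ∃ p : Fin k → G.Path x y,
    Pairwise fun i j => List.Disjoint (p i : G.Walk x y).edges (p j : G.Walk x y).edges

open Classical in
/-- `G` is connected and any two distinct vertices `x`, `y` are joined by
`min (deg x) (deg y)` edge-disjoint paths. -/
def StronglyMengerEdgeConnected {V : Type u} [Fintype V] (G : SimpleGraph V) : Prop :=
  G.Connected ∧ ∀ x y : V, x ≠ y → HasEdgeDisjointPaths G x y (min (G.degree x) (G.degree y))

open Classical in
/-- `T` is a set of edges of `G` whose deletion leaves a graph of minimum degree at least `2`. -/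
def IsConditionalFaultSet {V : Type u} [Fintype V] (G : SimpleGraph V)
    (T : Finset (Sym2 V)) : Prop :=
  (T : Set (Sym2 V)) ⊆ G.edgeSet ∧ 2 ≤ (G.deleteEdges (T : Set (Sym2 V))).minDegree

/-- `G` is `m`-conditional edge-fault-tolerant strongly Menger edge connected. -/
def IsConditionalEdgeFaultTolerantSMEC {V : Type u} [Fintype V] (m : ℕ)
    (G : SimpleGraph V) : Prop :=
  ∀ T : Finset (Sym2 V), IsConditionalFaultSet G T → T.card ≤ m →
    StronglyMengerEdgeConnected (G.deleteEdges (T : Set (Sym2 V)))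

/-! By the edge form of Menger's theorem it suffices to bound below, by the smaller of the two
degrees, every cut of `L_n - T` separating `x` from `y`. A side with at most two vertices is handled
by minimum degree two alone (`degree_le_card_edgeCut_of_card_le_two`). If both sides have at least
three vertices, the cut has at least `6n - 12` edges in `L_n`
(`IsHypercubeLike.le_card_edgeCut_lineGraph`); deleting `4n - 10` of them leaves `2n - 2`, the
degree in `L_n`.

For the cut bound, a vertex of `L_n` is an edge of the network. With `a v` edges at `v` on one side
and `b v` on the other, `a v + b v = n`, the cut has `∑ a v * b v` edges. If one of `a`, `b`
vanishes nowhere, concavity of `t * (n - t)` gives the bound. Otherwise the vertices where both are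
positive separate the zeros of `a` from those of `b`; by `n`-connectedness there are at least `n` of
them, each contributing at least `n - 1`.

For sharpness, take three edges at a common vertex, a triangle in `L_n`, and delete all but one of
the edges leaving two of its corners: the triangle's cut drops to `2n - 3`. -/

/-! ### Edge Menger theorem via integral unit flows -/

section EdgeMenger

open Finset

variable {V : Type u} {G : SimpleGraph V}

open Classical in
/-- The ordered pairs of adjacent vertices that leave `S`. -/
noncomputable def edgeCut [Fintype V] (G : SimpleGraph V) (S : Finset V) : Finset (V × V) :=
  univ.filter fun p => p.1 ∈ S ∧ p.2 ∉ S ∧ G.Adj p.1 p.2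

theorem mem_edgeCut [Fintype V] {S : Finset V} {p : V × V} :
    p ∈ edgeCut G S ↔ p.1 ∈ S ∧ p.2 ∉ S ∧ G.Adj p.1 p.2 := by
  simp [edgeCut]

open Classical in
/-- The unit flow along a walk. -/
noncomputable def walkFlow : ∀ {x y : V}, G.Walk x y → V → V → ℤ
  | _, _, .nil => fun _ _ => 0
  | _, _, .cons (u := a) (v := b) _ p => fun u v =>
      (if u = a ∧ v = b then 1 else 0) - (if u = b ∧ v = a then 1 else 0) + walkFlow p u v

theorem walkFlow_antisymm {x y : V} (p : G.Walk x y) (u v : V) :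
    walkFlow p u v = - walkFlow p v u := by
  induction p with
  | nil => simp [walkFlow]
  | cons h p ih =>
    simp only [walkFlow, ih]
    split_ifs <;> first | omega | (exfalso; tauto)

open Classical in
theorem sum_walkFlow [Fintype V] {x y : V} (p : G.Walk x y) (v : V) :
    ∑ w, walkFlow p v w = (if v = x then 1 else 0) - (if v = y then 1 else 0) := by
  induction p with
  | nil => simp [walkFlow]
  | cons h p ih =>
    simp only [walkFlow, sum_add_distrib, sum_sub_distrib, ih, ite_and]
    simp [Finset.sum_ite_irrel]

theorem walkFlow_of_notMem_edges {x y : V} (p : G.Walk x y) {u v : V} (h : s(u, v) ∉ p.edges) :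
    walkFlow p u v = 0 := by
  induction p with
  | nil => simp [walkFlow]
  | cons h' p ih =>
    simp only [SimpleGraph.Walk.edges_cons, List.mem_cons, not_or, Sym2.eq_iff] at h
    simp [walkFlow, ih h.2, if_neg h.1.1, if_neg h.1.2]

theorem walkFlow_of_mem_darts {x y : V} (p : G.Walk x y) (hp : p.edges.Nodup) {d : G.Dart}
    (h : d ∈ p.darts) : walkFlow p d.fst d.snd = 1 := by
  induction p with
  | nil => simp at h
  | cons h' p ih =>
    simp only [SimpleGraph.Walk.edges_cons, List.nodup_cons] at hp
    simp only [SimpleGraph.Walk.darts_cons, List.mem_cons] at h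
    rcases h with rfl | h
    · simp [walkFlow, walkFlow_of_notMem_edges p hp.1, h'.ne]
    · have h2 : s(d.fst, d.snd) ∈ p.edges := List.mem_map_of_mem h
      have h3 : s(d.fst, d.snd) ≠ s(_, _) := fun e => hp.1 (e ▸ h2)
      rw [ne_eq, Sym2.eq_iff, not_or] at h3
      simp [walkFlow, ih hp.2 h, if_neg h3.1, if_neg h3.2]

theorem walkFlow_cases {x y : V} (p : G.Walk x y) (hp : p.edges.Nodup) (u v : V) :
    (walkFlow p u v = 0 ∧ s(u, v) ∉ p.edges) ∨
      (walkFlow p u v = 1 ∧ ∃ d ∈ p.darts, d.fst = u ∧ d.snd = v) ∨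
      (walkFlow p u v = -1 ∧ ∃ d ∈ p.darts, d.fst = v ∧ d.snd = u) := by
  by_cases h : s(u, v) ∈ p.edges
  · right
    obtain ⟨d, hd, hde⟩ := List.mem_map.1 h
    have h1 := walkFlow_of_mem_darts p hp hd
    rcases Sym2.eq_iff.1 (show s(d.fst, d.snd) = s(u, v) from hde) with ⟨rfl, rfl⟩ | ⟨rfl, rfl⟩
    · exact .inl ⟨h1, d, hd, rfl, rfl⟩
    · refine .inr ⟨?_, d, hd, rfl, rfl⟩
      rw [walkFlow_antisymm, h1]
  · exact .inl ⟨walkFlow_of_notMem_edges p h, h⟩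

open Classical in
/-- `f` is an integral flow of value `k` from `x` to `y` in `G` with unit edge capacities. -/
structure IsUnitFlow [Fintype V] (G : SimpleGraph V) (x y : V) (k : ℤ) (f : V → V → ℤ) :
    Prop where
  antisymm : ∀ u v, f u v = - f v u
  le_one : ∀ u v, f u v ≤ 1
  adj : ∀ u v, f u v ≠ 0 → G.Adj u v
  sum_eq : ∀ v, ∑ w, f v w = (if v = x then k else 0) - (if v = y then k else 0)

/-- A walk along `R`-darts, or else a set separating `x` from `y` that no `R`-dart leaves. -/
theorem exists_path_or_closed_set [Fintype V] (G : SimpleGraph V) (R : V → V → Prop) (x y : V) :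
    (∃ p : G.Path x y, ∀ d ∈ (p : G.Walk x y).darts, R d.fst d.snd) ∨
      ∃ S : Finset V, x ∈ S ∧ y ∉ S ∧ ∀ u ∈ S, ∀ v ∉ S, G.Adj u v → ¬ R u v := by
  classical
  by_cases hy : ∃ p : G.Walk x y, ∀ d ∈ p.darts, R d.fst d.snd
  · obtain ⟨p, hp⟩ := hy
    exact .inl ⟨p.toPath, fun d hd => hp d (p.darts_toPath_subset_darts hd)⟩
  · refine .inr ⟨univ.filter fun z => ∃ p : G.Walk x z, ∀ d ∈ p.darts, R d.fst d.snd, ?_, ?_, ?_⟩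
    · simpa using ⟨.nil, by simp⟩
    · simpa using hy
    · intro u hu v hv h hR
      simp only [mem_filter, mem_univ, true_and] at hu hv
      obtain ⟨p, hp⟩ := hu
      refine hv ⟨p.concat h, fun d hd => ?_⟩
      rw [SimpleGraph.Walk.darts_concat, List.concat_eq_append, List.mem_append] at hd
      rcases hd with hd | hd
      · exact hp d hd
      · rw [List.mem_singleton] at hd
        subst hd
        exact hR

-- Sum conservation over `S`: terms inside `S` cancel by antisymmetry, leaving the flow across the
-- boundary.
open Classical in
theorem IsUnitFlow.sum_cut [Fintype V] {x y : V} {k : ℤ} {f : V → V → ℤ}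
    (hf : IsUnitFlow G x y k f) {S : Finset V} (hx : x ∈ S) (hy : y ∉ S) :
    ∑ p ∈ edgeCut G S, f p.1 p.2 = k := by
  have h1 : ∑ u ∈ S, ∑ w, f u w = k := by
    simp [hf.sum_eq, sum_sub_distrib, hx, hy]
  have h2 : ∑ u ∈ S, ∑ w ∈ S, f u w = 0 := by
    have h3 : ∑ u ∈ S, ∑ w ∈ S, f u w = - ∑ u ∈ S, ∑ w ∈ S, f u w := by
      conv_lhs => rw [sum_comm]
      rw [← sum_neg_distrib]
      refine sum_congr rfl fun u _ => ?_
      rw [← sum_neg_distrib]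
      exact sum_congr rfl fun w _ => hf.antisymm w u
    omega
  have h4 : ∑ u ∈ S, ∑ w ∈ Sᶜ, f u w = k := by
    rw [← h1]
    simp only [← sum_add_sum_compl S, sum_add_distrib, h2, zero_add]
  rw [← h4, ← sum_product']
  refine sum_subset (fun p hp => ?_) fun p hp hp' => ?_
  · rw [mem_edgeCut] at hp
    simp [hp.1, hp.2.1]
  · by_contra h0
    simp only [mem_product, mem_compl] at hp
    exact hp' (mem_edgeCut.2 ⟨hp.1, hp.2, hf.adj _ _ h0⟩)

/-- Ford–Fulkerson augmentation. A dart has residual capacity exactly when `f u v ≤ 0`; with no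
augmenting path, the residually reachable set has a saturated cut of only `k` edges. -/
theorem IsUnitFlow.exists_succ [Fintype V] {x y : V} {k : ℕ} {f : V → V → ℤ}
    (hf : IsUnitFlow G x y k f)
    (hcut : ∀ S : Finset V, x ∈ S → y ∉ S → k + 1 ≤ (edgeCut G S).card) :
    ∃ f', IsUnitFlow G x y (k + 1 : ℕ) f' := by
  classical
  rcases exists_path_or_closed_set G (fun u v => f u v ≤ 0) x y with ⟨p, hp⟩ | ⟨S, hx, hy, hS⟩
  · have hnd := p.2.isTrail.edges_nodup
    refine ⟨fun u v => f u v + walkFlow p.1 u v, fun u v => ?_, fun u v => ?_, fun u v h => ?_,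
      fun v => ?_⟩
    · rw [hf.antisymm, walkFlow_antisymm]; ring
    · rcases walkFlow_cases p.1 hnd u v with h | ⟨h, d, hd, rfl, rfl⟩ | h
      · have := hf.le_one u v; omega
      · have := hp d hd; omega
      · have := hf.le_one u v; omega
    · rcases walkFlow_cases p.1 hnd u v with h' | ⟨h', d, hd, rfl, rfl⟩ | ⟨h', d, hd, rfl, rfl⟩
      · exact hf.adj u v (by simpa [h'] using h)
      · exact d.adj
      · exact d.adj.symm
    · rw [sum_add_distrib, hf.sum_eq, sum_walkFlow]
      push_cast
      split_ifs <;> ring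
  · exfalso
    have h1 := hf.sum_cut hx hy
    have h2 : ∑ p ∈ edgeCut G S, f p.1 p.2 = ∑ p ∈ edgeCut G S, 1 := by
      refine sum_congr rfl fun p hp => ?_
      rw [mem_edgeCut] at hp
      have := hS _ hp.1 _ hp.2.1 hp.2.2
      have := hf.le_one p.1 p.2
      omega
    have h3 := hcut S hx hy
    rw [h2, sum_const, nsmul_one] at h1
    have : (edgeCut G S).card = k := by exact_mod_cast h1
    omega

/-- Flow decomposition: peel off a path of darts carrying flow `1` and recurse. The remaining flow
vanishes on the edges of that path, so later paths avoid them. -/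
theorem IsUnitFlow.exists_paths [Fintype V] {x y : V} {k : ℕ} {f : V → V → ℤ}
    (hf : IsUnitFlow G x y k f) :
    ∃ p : Fin k → G.Path x y,
      (∀ i, ∀ d ∈ (p i : G.Walk x y).darts, f d.fst d.snd = 1) ∧
      Pairwise fun i j => List.Disjoint (p i : G.Walk x y).edges (p j : G.Walk x y).edges := by
  classical
  induction k generalizing f with
  | zero => exact ⟨Fin.elim0, fun i => i.elim0, fun i => i.elim0⟩
  | succ k ih =>
    rcases exists_path_or_closed_set G (fun u v => f u v = 1) x y with ⟨p, hp⟩ | ⟨S, hx, hy, hS⟩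
    · have hnd := p.2.isTrail.edges_nodup
      have key : ∀ u v, (f u v - walkFlow p.1 u v = f u v ∧ s(u, v) ∉ p.1.edges) ∨
          f u v - walkFlow p.1 u v = 0 := by
        intro u v
        rcases walkFlow_cases p.1 hnd u v with h | ⟨h, d, hd, rfl, rfl⟩ | ⟨h, d, hd, rfl, rfl⟩
        · exact .inl ⟨by omega, h.2⟩
        · have := hp d hd; right; omega
        · have := hp d hd; have := hf.antisymm d.snd d.fst; right; omega
      have hf' : IsUnitFlow G x y k fun u v => f u v - walkFlow p.1 u v := by
        refine ⟨fun u v => ?_, fun u v => ?_, fun u v h => ?_, fun v => ?_⟩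
        · rw [hf.antisymm, walkFlow_antisymm]; ring
        · rcases key u v with h | h
          · rw [h.1]; exact hf.le_one u v
          · rw [h]; exact zero_le_one
        · rcases key u v with h' | h'
          · exact hf.adj u v (h'.1 ▸ h)
          · exact absurd h' h
        · rw [sum_sub_distrib, hf.sum_eq, sum_walkFlow]
          push_cast
          split_ifs <;> ring
      obtain ⟨q, hq, hqd⟩ := ih hf'
      have hq' : ∀ i, ∀ d ∈ (q i : G.Walk x y).darts,
          f d.fst d.snd = 1 ∧ s(d.fst, d.snd) ∉ p.1.edges := by
        intro i d hd
        have h1 := hq i d hd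
        rcases key d.fst d.snd with h | h
        · exact ⟨by omega, h.2⟩
        · omega
      have hdis : ∀ i, List.Disjoint (q i : G.Walk x y).edges p.1.edges := by
        intro i e he he'
        obtain ⟨d, hd, rfl⟩ := List.mem_map.1 he
        exact (hq' i d hd).2 he'
      refine ⟨Fin.cons p q, fun i => ?_, fun i j hij => ?_⟩
      · refine Fin.cases ?_ (fun i => ?_) i
        · simpa using hp
        · simpa using fun d hd => (hq' i d hd).1
      · rcases Fin.eq_zero_or_eq_succ i with rfl | ⟨i, rfl⟩ <;>
          rcases Fin.eq_zero_or_eq_succ j with rfl | ⟨j, rfl⟩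
        · exact absurd rfl hij
        · simpa using (hdis j).symm
        · simpa using hdis i
        · simpa using hqd fun h => hij (congrArg _ h)
    · exfalso
      have h1 := hf.sum_cut hx hy
      have h2 : ∑ p ∈ edgeCut G S, f p.1 p.2 ≤ 0 := by
        refine sum_nonpos fun p hp => ?_
        rw [mem_edgeCut] at hp
        have := hS _ hp.1 _ hp.2.1 hp.2.2
        have := hf.le_one p.1 p.2
        omega
      push_cast at h1
      omega

/-- The edge version of Menger's theorem. -/
theorem hasEdgeDisjointPaths_of_le_card_edgeCut [Fintype V] {x y : V} {k : ℕ}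
    (hcut : ∀ S : Finset V, x ∈ S → y ∉ S → k ≤ (edgeCut G S).card) :
    HasEdgeDisjointPaths G x y k := by
  have : ∀ j ≤ k, ∃ f, IsUnitFlow G x y j f := by
    intro j
    induction j with
    | zero => exact fun _ => ⟨fun _ _ => 0, by constructor <;> simp⟩
    | succ j ih =>
      intro hj
      obtain ⟨f, hf⟩ := ih (by omega)
      exact hf.exists_succ fun S hx hy => hj.trans (hcut S hx hy)
  obtain ⟨f, hf⟩ := this k le_rfl
  obtain ⟨p, -, hp⟩ := hf.exists_paths
  exact ⟨p, hp⟩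

/-- Edge-disjoint paths out of `S` use different edges of any edge set containing the boundary
of `S`. -/
theorem HasEdgeDisjointPaths.le_card {x y : V} {k : ℕ} (h : HasEdgeDisjointPaths G x y k)
    {S : Set V} (hx : x ∈ S) (hy : y ∉ S) {C : Finset (Sym2 V)}
    (hC : ∀ u ∈ S, ∀ v ∉ S, G.Adj u v → s(u, v) ∈ C) : k ≤ C.card := by
  obtain ⟨p, hp⟩ := h
  have : ∀ i, ∃ e ∈ (p i : G.Walk x y).edges, e ∈ C := by
    intro i
    obtain ⟨d, hd, h1, h2⟩ := (p i : G.Walk x y).exists_boundary_dart S hx hy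
    exact ⟨d.edge, List.mem_map_of_mem hd, hC _ h1 _ h2 d.adj⟩
  choose e he heC using this
  have hinj : Function.Injective e := by
    intro i j hij
    by_contra hne
    exact hp hne (he i) (hij ▸ he j)
  simpa using card_le_card_of_injOn (s := (univ : Finset (Fin k))) e (fun i _ => heC i)
    hinj.injOn

end EdgeMenger

/-! ### Regularity and vertex connectivity of hypercube-like networks -/

section HypercubeLike

variable {V : Type u} {G : SimpleGraph V} {n : ℕ}

theorem IsHypercubeLike.one_le (h : IsHypercubeLike n G) : 1 ≤ n := by
  cases h <;> omega

theorem IsHypercubeLike.finite_and_card (h : IsHypercubeLike n G) :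
    Finite V ∧ Nat.card V = 2 ^ n := by
  induction h with
  | one e =>
    refine ⟨Finite.of_equiv _ e.toEquiv.symm, ?_⟩
    rw [Nat.card_congr e.toEquiv]
    simp
  | step h₁ h₂ f e ih₁ ih₂ =>
    obtain ⟨_, hc₁⟩ := ih₁
    obtain ⟨_, hc₂⟩ := ih₂
    refine ⟨Finite.of_equiv _ e.toEquiv.symm, ?_⟩
    rw [Nat.card_congr e.toEquiv, Nat.card_sum, hc₁, hc₂, pow_succ, mul_two]

section MatchingJoin

variable {V₁ : Type u} {V₂ : Type v} {G₁ : SimpleGraph V₁} {G₂ : SimpleGraph V₂} {f : V₁ ≃ V₂}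

theorem ncard_neighborSet_matchingJoin_inl [Finite V₁] (a : V₁) :
    ((matchingJoin G₁ G₂ f).neighborSet (.inl a)).ncard = (G₁.neighborSet a).ncard + 1 := by
  have : (matchingJoin G₁ G₂ f).neighborSet (.inl a) =
      insert (.inr (f a)) (Sum.inl '' G₁.neighborSet a) := by
    ext (b | b) <;> simp [matchingJoin, eq_comm]
  rw [this, Set.ncard_insert_of_notMem (by simp) (Set.toFinite _),
    Set.ncard_image_of_injective _ Sum.inl_injective]

theorem ncard_neighborSet_matchingJoin_inr [Finite V₂] (a : V₂) :
    ((matchingJoin G₁ G₂ f).neighborSet (.inr a)).ncard = (G₂.neighborSet a).ncard + 1 := by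
  have : (matchingJoin G₁ G₂ f).neighborSet (.inr a) =
      insert (.inl (f.symm a)) (Sum.inr '' G₂.neighborSet a) := by
    ext (b | b) <;> simp [matchingJoin, Equiv.eq_symm_apply]
  rw [this, Set.ncard_insert_of_notMem (by simp) (Set.toFinite _),
    Set.ncard_image_of_injective _ Sum.inr_injective]

end MatchingJoin

theorem SimpleGraph.Iso.ncard_neighborSet {W : Type v} {H : SimpleGraph W} (e : G ≃g H) (v : V) :
    (G.neighborSet v).ncard = (H.neighborSet (e v)).ncard := by
  rw [← Nat.card_coe_set_eq, ← Nat.card_coe_set_eq]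
  exact Nat.card_congr (e.mapNeighborSet v)

theorem IsHypercubeLike.ncard_neighborSet (h : IsHypercubeLike n G) (v : V) :
    (G.neighborSet v).ncard = n := by
  induction h with
  | one e =>
    rw [e.ncard_neighborSet]
    have : (⊤ : SimpleGraph (Fin 2)).neighborSet (e v) = {e v}ᶜ := by
      ext; simp
    rw [this, Set.ncard_compl]
    simp
  | step h₁ h₂ f e ih₁ ih₂ =>
    have := h₁.finite_and_card.1
    have := h₂.finite_and_card.1
    rw [e.ncard_neighborSet]
    rcases e v with a | a
    · rw [ncard_neighborSet_matchingJoin_inl, ih₁]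
    · rw [ncard_neighborSet_matchingJoin_inr, ih₂]

theorem Set.ncard_sum_eq {V₁ : Type u} {V₂ : Type v} [Finite V₁] [Finite V₂] (S : Set (V₁ ⊕ V₂)) :
    S.ncard = (Sum.inl ⁻¹' S).ncard + (Sum.inr ⁻¹' S).ncard := by
  conv_lhs => rw [← Set.image_preimage_inl_union_image_preimage_inr S]
  rw [Set.ncard_union_eq, Set.ncard_image_of_injective _ Sum.inl_injective,
    Set.ncard_image_of_injective _ Sum.inr_injective]
  rw [Set.disjoint_left]
  rintro _ ⟨a, -, rfl⟩ ⟨b, -, h⟩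
  cases h

/-- A hypercube-like network of dimension `n` is `n`-connected. -/
theorem IsHypercubeLike.le_ncard_separator (h : IsHypercubeLike n G) {A B : Set V}
    (hA : A.Nonempty) (hB : B.Nonempty) (hAB : Disjoint A B)
    (hadj : ∀ a ∈ A, ∀ b ∈ B, ¬ G.Adj a b) : n ≤ (A ∪ B)ᶜ.ncard := by
  induction h with
  | one e =>
    obtain ⟨a, ha⟩ := hA
    obtain ⟨b, hb⟩ := hB
    have hne : a ≠ b := fun h => Set.disjoint_left.1 hAB ha (h ▸ hb)
    refine absurd ?_ (hadj a ha b hb)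
    rw [← e.map_adj_iff]
    simpa using hne
  | @step n V₁ V₂ V G₁ G₂ G h₁ h₂ f e ih₁ ih₂ =>
    obtain ⟨_, hc₁⟩ := h₁.finite_and_card
    obtain ⟨_, hc₂⟩ := h₂.finite_and_card
    have hpos := h₁.one_le
    have hpow : n < 2 ^ n := Nat.lt_two_pow_self
    set A' : Set (V₁ ⊕ V₂) := e.symm ⁻¹' A with hA'
    set B' : Set (V₁ ⊕ V₂) := e.symm ⁻¹' B with hB'
    have hd : ∀ z ∈ A', z ∉ B' := fun z h h' => Set.disjoint_left.1 hAB h h'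
    have hadj' : ∀ a ∈ A', ∀ b ∈ B', ¬ (matchingJoin G₁ G₂ f).Adj a b := by
      intro a ha b hb hab
      exact hadj _ ha _ hb (e.symm.map_adj_iff.2 hab)
    have hA0 : 0 < A'.ncard := (Set.ncard_pos (Set.toFinite _)).2 (hA.preimage e.symm.surjective)
    have hB0 : 0 < B'.ncard := (Set.ncard_pos (Set.toFinite _)).2 (hB.preimage e.symm.surjective)
    have hcard : (A ∪ B)ᶜ.ncard = (A' ∪ B')ᶜ.ncard := by
      rw [hA', hB', ← Set.preimage_union, ← Set.preimage_compl,
        Set.ncard_preimage_of_injective_subset_range e.symm.injective]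
      simp [e.symm.surjective.range_eq]
    rw [hcard, Set.ncard_sum_eq, Set.preimage_compl, Set.preimage_compl, Set.preimage_union,
      Set.preimage_union]
    rw [Set.ncard_sum_eq] at hA0 hB0
    set A₁ := Sum.inl ⁻¹' A'
    set B₁ := Sum.inl ⁻¹' B'
    set A₂ := Sum.inr ⁻¹' A'
    set B₂ := Sum.inr ⁻¹' B'
    have d₁ : Disjoint A₁ B₁ := Set.disjoint_left.2 fun z h => hd _ h
    have d₂ : Disjoint A₂ B₂ := Set.disjoint_left.2 fun z h => hd _ h
    have i₁ : 0 < A₁.ncard → 0 < B₁.ncard → n ≤ (A₁ ∪ B₁)ᶜ.ncard := fun hA hB =>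
      ih₁ ((Set.ncard_pos (Set.toFinite _)).1 hA) ((Set.ncard_pos (Set.toFinite _)).1 hB) d₁ fun a ha b hb => hadj' _ ha _ hb
    have i₂ : 0 < A₂.ncard → 0 < B₂.ncard → n ≤ (A₂ ∪ B₂)ᶜ.ncard := fun hA hB =>
      ih₂ ((Set.ncard_pos (Set.toFinite _)).1 hA) ((Set.ncard_pos (Set.toFinite _)).1 hB) d₂ fun a ha b hb => hadj' _ ha _ hb
    have s₁ := Set.ncard_add_ncard_compl (A₁ ∪ B₁)
    have s₂ := Set.ncard_add_ncard_compl (A₂ ∪ B₂)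
    rw [Set.ncard_union_eq d₁, hc₁] at s₁
    rw [Set.ncard_union_eq d₂, hc₂] at s₂
    have mAB : ∀ a ∈ A₁, f a ∉ B₂ := fun a ha hb => hadj' _ ha _ hb rfl
    have mBA : ∀ b ∈ B₁, f b ∉ A₂ := fun b hb ha => hadj' _ ha _ hb rfl
    -- The matching sends `A₁` off `B₂`, so if `A₂` is empty the image of `A₁` lies in the
    -- separator.
    have j₁ : A₂.ncard = 0 → A₁.ncard ≤ (A₂ ∪ B₂)ᶜ.ncard := fun h => by
      rw [Set.ncard_eq_zero] at h
      rw [h, Set.empty_union]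
      exact Set.ncard_le_ncard_of_injOn f mAB f.injective.injOn
    have j₂ : B₂.ncard = 0 → B₁.ncard ≤ (A₂ ∪ B₂)ᶜ.ncard := fun h => by
      rw [Set.ncard_eq_zero] at h
      rw [h, Set.union_empty]
      exact Set.ncard_le_ncard_of_injOn f mBA f.injective.injOn
    have j₃ : A₁.ncard = 0 → A₂.ncard ≤ (A₁ ∪ B₁)ᶜ.ncard := fun h => by
      rw [Set.ncard_eq_zero] at h
      rw [h, Set.empty_union]
      exact Set.ncard_le_ncard_of_injOn f.symm
        (fun a ha hb => mBA _ hb (by simpa using ha)) f.symm.injective.injOn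
    have j₄ : B₁.ncard = 0 → B₂.ncard ≤ (A₁ ∪ B₁)ᶜ.ncard := fun h => by
      rw [Set.ncard_eq_zero] at h
      rw [h, Set.union_empty]
      exact Set.ncard_le_ncard_of_injOn f.symm
        (fun a ha hb => mAB _ hb (by simpa using ha)) f.symm.injective.injOn
    -- If both halves meet `A` and `B`, induction gives `2n`. If just one half does, it gives `n`,
    -- and the matching forces one more vertex in the other half. If neither does, the separator has
    -- at least `2 ^ n > n` vertices.
    omega

end HypercubeLike

/-! ### Edge cuts in line graphs -/

section LineGraph

open Finset

variable {V : Type u} {Q : SimpleGraph V}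

open Classical in
/-- The number of edges in `X` incident with `v`. -/
noncomputable def incidenceCount (X : Finset Q.edgeSet) (v : V) : ℕ :=
  (X.filter fun e => v ∈ e.1).card

theorem lineGraph_adj_iff {e e' : Q.edgeSet} :
    Q.lineGraph.Adj e e' ↔ e ≠ e' ∧ ∃ v, v ∈ e.1 ∧ v ∈ e'.1 := Iff.rfl

theorem eq_of_mem_of_mem {e e' : Q.edgeSet} {v w : V} (hvw : v ≠ w) (hv : v ∈ e.1) (hw : w ∈ e.1)
    (hv' : v ∈ e'.1) (hw' : w ∈ e'.1) : e = e' :=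
  Subtype.ext (((Sym2.mem_and_mem_iff hvw).1 ⟨hv, hw⟩).trans
    ((Sym2.mem_and_mem_iff hvw).1 ⟨hv', hw'⟩).symm)

variable {n : ℕ}

open Classical in
theorem incidenceCount_add_compl [Fintype Q.edgeSet] (X : Finset Q.edgeSet) (v : V) :
    incidenceCount X v + incidenceCount Xᶜ v = (Q.neighborSet v).ncard := by
  rw [incidenceCount, incidenceCount, ← card_union_of_disjoint
    (disjoint_filter_filter disjoint_compl_right), ← filter_union, union_compl,
    ← Nat.card_coe_set_eq, ← Nat.card_congr (Q.incidenceSetEquivNeighborSet v),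
    Nat.card_coe_set_eq, ← Set.ncard_coe_finset,
    ← Set.ncard_image_of_injective _ Subtype.val_injective]
  congr 1
  ext e
  simp [SimpleGraph.incidenceSet, and_comm]

/-- If `X` misses an edge at every vertex, then the edges of `X` at `v` lead to other vertices
incident with `X`. -/
theorem incidenceCount_lt {X : Finset Q.edgeSet} {v : V} {M : Finset V} (hv : v ∈ M)
    (hM : ∀ w, 0 < incidenceCount X w → w ∈ M) : incidenceCount X v < M.card := by
  classical
  have h1 : (X.filter fun e => v ∈ e.1).image Subtype.val ⊆
      (M.erase v).image fun w => s(v, w) := by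
    intro e he
    simp only [mem_image, mem_filter] at he
    obtain ⟨⟨e, heQ⟩, ⟨heX, hve⟩, rfl⟩ := he
    obtain ⟨w, rfl⟩ := Sym2.mem_iff_exists.1 hve
    refine mem_image.2 ⟨w, mem_erase.2 ⟨(Q.ne_of_adj heQ).symm, hM w ?_⟩, rfl⟩
    exact card_pos.2 ⟨_, mem_filter.2 ⟨heX, by simp⟩⟩
  have h2 := (card_le_card h1).trans card_image_le
  rw [card_image_of_injective _ Subtype.val_injective, card_erase_of_mem hv] at h2
  have : 0 < M.card := card_pos.2 ⟨v, hv⟩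
  have h3 : incidenceCount X v ≤ M.card - 1 := by
    rw [incidenceCount]; exact h2
  omega

theorem sum_incidenceCount [Fintype V] (X : Finset Q.edgeSet) :
    ∑ v, incidenceCount X v = 2 * X.card := by
  classical
  have := sum_card_bipartiteAbove_eq_sum_card_bipartiteBelow (s := (univ : Finset V)) (t := X)
    fun v e => v ∈ e.1
  have h2 : ∀ e ∈ X, (bipartiteBelow (fun (v : V) (e : Q.edgeSet) => v ∈ e.1) univ e).card = 2 := by
    rintro ⟨e, he⟩ -
    induction e with
    | _ a b =>
      have : bipartiteBelow (fun (v : V) (e : Q.edgeSet) => v ∈ e.1) univ ⟨s(a, b), he⟩ =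
          {a, b} := by
        ext; simp [bipartiteBelow]
      rw [this, card_pair (Q.ne_of_adj he)]
  rw [sum_congr rfl h2, sum_const, smul_eq_mul, mul_comm] at this
  rw [← this]
  refine sum_congr rfl fun v _ => ?_
  rw [incidenceCount, bipartiteAbove]

/-- On `[1, c]` the concave function `t * (n - t)` lies above its chord, `(n - 1) + (t - 1) * (n - 1
- c)`. The slope is nonnegative, so `∑ a v` may be replaced by its lower bound `6` after summing. -/
theorem chord_bound_sum {M : Finset V} {a b : V → ℕ} {n c : ℕ} (hcn : c + 1 ≤ n)
    (hab : ∀ v, a v + b v = n) (ha : ∀ v ∈ M, 1 ≤ a v) (hac : ∀ v ∈ M, a v ≤ c)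
    (hs : 6 ≤ ∑ v ∈ M, a v) :
    (M.card * (n - 1) + (6 - M.card) * (n - 1 - c) : ℤ) ≤ (∑ v ∈ M, a v * b v : ℕ) := by
  have h1 : ∀ v ∈ M, ((n - 1 : ℤ) + (a v - 1) * (n - 1 - c)) ≤ a v * b v := by
    intro v hv
    have hb : (b v : ℤ) = n - a v := by have := hab v; omega
    have h2 : (0 : ℤ) ≤ (a v - 1) * (c - a v) := by
      have := ha v hv
      have := hac v hv
      exact mul_nonneg (by omega) (by omega)
    rw [hb]
    nlinarith
  have h2 := sum_le_sum h1
  have h5 : ∑ v ∈ M, ((a v : ℤ) - 1) = ∑ v ∈ M, (a v : ℤ) - M.card := by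
    simp [sum_sub_distrib]
  rw [sum_add_distrib, ← sum_mul, h5, sum_const, nsmul_eq_mul] at h2
  have h3 : (6 : ℤ) ≤ ∑ v ∈ M, (a v : ℤ) := by exact_mod_cast hs
  have h4 : (0 : ℤ) ≤ n - 1 - c := by omega
  rw [Nat.cast_sum]
  push_cast
  nlinarith

theorem le_sum_mul_of_lt_card {M : Finset V} {a b : V → ℕ} (hn : 4 ≤ n)
    (hab : ∀ v, a v + b v = n) (ha : ∀ v ∈ M, 1 ≤ a v) (hb : ∀ v ∈ M, 1 ≤ b v)
    (haM : ∀ v ∈ M, a v < M.card) (hs : 6 ≤ ∑ v ∈ M, a v) :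
    6 * n - 12 ≤ ∑ v ∈ M, a v * b v := by
  have han : ∀ v ∈ M, a v ≤ n - 1 := fun v hv => by have := hab v; have := hb v hv; omega
  have hk : 3 ≤ M.card := by
    by_contra! h
    have : ∑ v ∈ M, a v ≤ M.card • 1 := sum_le_card_nsmul M a 1 fun v hv => by have := haM v hv; omega
    rw [smul_eq_mul, mul_one] at this
    omega
  -- Sizes 3 and 4, with `c = M.card - 1`, both give exactly `6n - 12`. From size 5 on, the flat
  -- chord `c = n - 1` gives `M.card * (n - 1)`, enough except for size 5 with `n ≥ 5`, where `c =
  -- 4` gives `6n - 10`.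
  rcases Nat.lt_or_ge M.card 5 with h5 | h5
  · have := chord_bound_sum (c := M.card - 1) (by omega) hab ha
      (fun v hv => by have := haM v hv; omega) hs
    obtain h | h : M.card = 3 ∨ M.card = 4 := by omega
    all_goals rw [h] at this; push_cast [- Nat.cast_sum] at this; omega
  · have h1 := chord_bound_sum (c := n - 1) (by omega) hab ha han hs
    have h2 : ((n - 1 : ℕ) : ℤ) = n - 1 := by omega
    rw [h2, sub_self, mul_zero, add_zero] at h1
    rcases Nat.lt_or_ge M.card 6 with h6 | h6
    · have h : M.card = 5 := by omega
      rcases Nat.lt_or_ge n 5 with hn5 | hn5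
      · rw [h] at h1; push_cast [- Nat.cast_sum] at h1; omega
      · have := chord_bound_sum (c := 4) (by omega) hab ha
          (fun v hv => by have := haM v hv; omega) hs
        rw [h] at this; push_cast [- Nat.cast_sum] at this; omega
    · have : (6 * (n - 1) : ℤ) ≤ M.card * (n - 1) :=
        mul_le_mul_of_nonneg_right (by omega) (by omega)
      omega

variable [Fintype V] [Fintype Q.edgeSet]

-- Distinct edges of a simple graph share at most one endpoint, so each cut pair is counted at
-- exactly one `v`.
open Classical in
theorem card_edgeCut_lineGraph (X : Finset Q.edgeSet) :
    (edgeCut Q.lineGraph X).card = ∑ v, incidenceCount X v * incidenceCount Xᶜ v := by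
  have : edgeCut Q.lineGraph X = univ.biUnion fun v =>
      (X.filter fun e => v ∈ e.1) ×ˢ (Xᶜ.filter fun e => v ∈ e.1) := by
    ext ⟨e, e'⟩
    simp only [mem_edgeCut, lineGraph_adj_iff, mem_biUnion, mem_univ, true_and, mem_product,
      mem_filter, mem_compl]
    constructor
    · rintro ⟨h1, h2, -, v, hv, hv'⟩
      exact ⟨v, ⟨h1, hv⟩, h2, hv'⟩
    · rintro ⟨v, ⟨h1, hv⟩, h2, hv'⟩
      exact ⟨h1, h2, fun h => h2 (h ▸ h1), v, hv, hv'⟩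
  rw [this, card_biUnion]
  · simp [incidenceCount]
  · intro v _ w _ hvw
    refine disjoint_left.2 ?_
    rintro ⟨e, e'⟩ h h'
    simp only [mem_product, mem_filter, mem_compl] at h h'
    exact h.2.1 (eq_of_mem_of_mem hvw h.1.2 h'.1.2 h.2.2 h'.2.2 ▸ h.1.1)

-- Apply the concavity bound to the vertices touched by `X`; the required `6` is twice the three
-- edges of `X`.
open Classical in
theorem le_sum_incidenceCount_mul_of_compl_pos (hn : 4 ≤ n)
    (hreg : ∀ v, (Q.neighborSet v).ncard = n) {X : Finset Q.edgeSet} (hX : 3 ≤ X.card)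
    (hpos : ∀ v, 0 < incidenceCount Xᶜ v) :
    6 * n - 12 ≤ ∑ v, incidenceCount X v * incidenceCount Xᶜ v := by
  set M : Finset V := univ.filter fun v => 0 < incidenceCount X v with hM
  refine le_trans (le_sum_mul_of_lt_card (M := M) hn
    (fun v => (incidenceCount_add_compl X v).trans (hreg v)) (fun v hv => (mem_filter.1 hv).2)
    (fun v _ => hpos v) (fun v hv => incidenceCount_lt hv fun w hw => by simpa [hM] using hw) ?_)
    (sum_le_sum_of_subset (subset_univ M))
  have h := sum_incidenceCount X
  have h' : ∑ v ∈ M, incidenceCount X v = ∑ v, incidenceCount X v :=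
    sum_subset (subset_univ M) fun v _ hv => by simpa [hM] using hv
  omega

open Classical in
/-- Any edge cut of the line graph of a hypercube-like network with at least three vertices on
each side has at least `6n - 12` edges. -/
theorem IsHypercubeLike.le_card_edgeCut_lineGraph (hQ : IsHypercubeLike n Q) (hn : 4 ≤ n)
    {X : Finset Q.edgeSet} (hX : 3 ≤ X.card) (hX' : 3 ≤ Xᶜ.card) :
    6 * n - 12 ≤ (edgeCut Q.lineGraph X).card := by
  have hreg := hQ.ncard_neighborSet
  have hab : ∀ v, incidenceCount X v + incidenceCount Xᶜ v = n := fun v =>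
    (incidenceCount_add_compl X v).trans (hreg v)
  rw [card_edgeCut_lineGraph]
  by_cases hA : ∀ v, 0 < incidenceCount Xᶜ v
  · exact le_sum_incidenceCount_mul_of_compl_pos hn hreg hX hA
  by_cases hB : ∀ v, 0 < incidenceCount X v
  · have := le_sum_incidenceCount_mul_of_compl_pos hn hreg hX' (by simpa using hB)
    simpa only [compl_compl, mul_comm] using this
  push Not at hA hB
  obtain ⟨p, hp⟩ := hA
  obtain ⟨q, hq⟩ := hB
  set M : Finset V := univ.filter fun v => 0 < incidenceCount X v ∧ 0 < incidenceCount Xᶜ v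
    with hM
  -- An edge joining the two sets could lie neither in `X` nor in its complement.
  have hsep := hQ.le_ncard_separator (A := {v | incidenceCount Xᶜ v = 0})
    (B := {v | incidenceCount X v = 0}) ⟨p, by simpa using hp⟩ ⟨q, by simpa using hq⟩
    (Set.disjoint_left.2 fun v h h' => by
      have := hab v
      simp only [Set.mem_ofPred_eq] at h h'
      omega)
    (by
      intro a ha b hb hadj
      simp only [Set.mem_ofPred_eq, incidenceCount, card_eq_zero] at ha hb
      by_cases h : (⟨s(a, b), hadj⟩ : Q.edgeSet) ∈ X
      · exact (eq_empty_iff_forall_notMem.1 hb ⟨s(a, b), hadj⟩) (by simp [h])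
      · exact (eq_empty_iff_forall_notMem.1 ha ⟨s(a, b), hadj⟩) (by simp [h]))
  have hMc : ({v | incidenceCount Xᶜ v = 0} ∪ {v | incidenceCount X v = 0})ᶜ = (M : Set V) := by
    ext v
    simp [hM, Nat.pos_iff_ne_zero, and_comm]
  rw [hMc, Set.ncard_coe_finset] at hsep
  have h1 : ∀ v ∈ M, n - 1 ≤ incidenceCount X v * incidenceCount Xᶜ v := by
    intro v hv
    obtain ⟨-, h1, h2⟩ := mem_filter.1 hv
    have := hab v
    obtain ⟨a, ha⟩ := Nat.exists_eq_add_of_lt h1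
    obtain ⟨b, hb⟩ := Nat.exists_eq_add_of_lt h2
    rw [ha, hb] at this ⊢
    rw [← this]
    have : 0 ≤ a * b := Nat.zero_le _
    ring_nf
    omega
  have h2 := card_nsmul_le_sum M _ _ h1
  have h3 := sum_le_sum_of_subset (f := fun v => incidenceCount X v * incidenceCount Xᶜ v)
    (subset_univ M)
  have h4 : n * (n - 1) ≤ M.card * (n - 1) := Nat.mul_le_mul_right _ hsep
  -- The difference is `(n - 3) * (n - 4)`.
  have h5 : 6 * n - 12 ≤ n * (n - 1) := by
    obtain ⟨m, rfl⟩ := Nat.exists_eq_add_of_le hn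
    have : 0 ≤ m * m := Nat.zero_le _
    have : 4 + m - 1 = 3 + m := by omega
    rw [this]
    ring_nf
    omega
  rw [smul_eq_mul] at h2
  omega

/-- The line graph of an `n`-regular graph is `(2n - 2)`-regular. -/
theorem card_filter_lineGraph_adj (hreg : ∀ v, (Q.neighborSet v).ncard = n) (e : Q.edgeSet)
    [DecidablePred (Q.lineGraph.Adj e)] :
    (univ.filter (Q.lineGraph.Adj e)).card = 2 * n - 2 := by
  classical
  -- The degree is the cut of a singleton, to which each endpoint of `e` contributes `n - 1`.
  have h1 : (edgeCut Q.lineGraph {e}).card = (univ.filter (Q.lineGraph.Adj e)).card := by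
    have : edgeCut Q.lineGraph {e} =
        (univ.filter (Q.lineGraph.Adj e)).map ⟨fun e' => (e, e'), Prod.mk_right_injective e⟩ := by
      ext ⟨a, b⟩
      simp only [mem_edgeCut, mem_singleton, mem_map, mem_filter, mem_univ, true_and,
        Function.Embedding.coeFn_mk, Prod.mk.injEq]
      constructor
      · rintro ⟨rfl, h2, h3⟩
        exact ⟨b, h3, rfl, rfl⟩
      · rintro ⟨c, h, rfl, rfl⟩
        exact ⟨rfl, h.ne', h⟩
    rw [this, card_map]
  rw [← h1, card_edgeCut_lineGraph]
  have h2 : ∀ v, incidenceCount {e} v * incidenceCount ({e} : Finset Q.edgeSet)ᶜ v =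
      incidenceCount {e} v * (n - 1) := by
    intro v
    have h3 := (incidenceCount_add_compl {e} v).trans (hreg v)
    have h4 : incidenceCount ({e} : Finset Q.edgeSet) v ≤ 1 :=
      (card_filter_le _ _).trans (card_singleton e).le
    rcases Nat.eq_zero_or_pos (incidenceCount ({e} : Finset Q.edgeSet) v) with h | h
    · simp [h]
    · congr 1
      omega
  rw [sum_congr rfl fun v _ => h2 v, ← sum_mul, sum_incidenceCount, card_singleton]
  omega

end LineGraph

/-! ### Criteria for and against strong Menger edge connectivity -/

section MengerCriteria

open Finset

variable {V : Type u} [Fintype V] {G : SimpleGraph V}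

theorem degree_eq_card_filter (G : SimpleGraph V) (v : V) [Fintype (G.neighborSet v)]
    [DecidablePred (G.Adj v)] : G.degree v = (univ.filter (G.Adj v)).card := by
  rw [← G.card_neighborFinset_eq_degree]
  congr 1
  ext w
  simp

theorem IsConditionalFaultSet.two_le_degree {T : Finset (Sym2 V)}
    (h : IsConditionalFaultSet G T) (v : V)
    [Fintype ((G.deleteEdges (T : Set (Sym2 V))).neighborSet v)] :
    2 ≤ (G.deleteEdges (T : Set (Sym2 V))).degree v := by
  classical
  have h1 := h.2.trans (SimpleGraph.minDegree_le_degree _ v)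
  rw [degree_eq_card_filter] at h1 ⊢
  exact h1

open Classical in
theorem card_edgeCut_compl (S : Finset V) : (edgeCut G Sᶜ).card = (edgeCut G S).card := by
  refine card_bij (fun p _ => p.swap) (fun p hp => ?_) (fun p _ q _ h => Prod.swap_injective h)
    fun p hp => ⟨p.swap, ?_, p.swap_swap⟩
  · rw [mem_edgeCut] at hp ⊢
    exact ⟨by simpa using hp.2.1, by simpa using hp.1, hp.2.2.symm⟩
  · rw [mem_edgeCut] at hp ⊢
    exact ⟨by simpa using hp.2.1, by simpa using hp.1, hp.2.2.symm⟩

/-- Cut pairs are oriented out of `S`, so each deleted edge accounts for at most one lost pair. -/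
theorem card_edgeCut_le_deleteEdges (S : Finset V) (T : Finset (Sym2 V)) :
    (edgeCut G S).card ≤ (edgeCut (G.deleteEdges (T : Set (Sym2 V))) S).card + T.card := by
  classical
  have h1 : (edgeCut G S \ edgeCut (G.deleteEdges (T : Set (Sym2 V))) S).card ≤ T.card := by
    refine card_le_card_of_injOn (fun p => s(p.1, p.2)) (fun p hp => ?_) fun p hp q hq h => ?_
    · simp only [coe_sdiff, Set.mem_sdiff, mem_coe, mem_edgeCut, SimpleGraph.deleteEdges_adj] at hp
      simp only [mem_coe]
      tauto
    · simp only [coe_sdiff, Set.mem_sdiff, mem_coe, mem_edgeCut] at hp hq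
      rcases Sym2.eq_iff.1 h with ⟨h1, h2⟩ | ⟨h1, h2⟩
      · exact Prod.ext h1 h2
      · exact absurd (h1 ▸ hp.1.1) hq.1.2.1
  have h2 := le_card_sdiff (edgeCut (G.deleteEdges (T : Set (Sym2 V))) S) (edgeCut G S)
  omega

-- For `S = {x, z}`, only the edge `xz` at `x` can fail to cross; a neighbour of `z` other than `x`
-- compensates for it.
open Classical in
theorem degree_le_card_edgeCut_of_card_le_two (hdeg : ∀ v, 2 ≤ G.degree v) {S : Finset V} {x : V}
    (hx : x ∈ S) (hS : S.card ≤ 2) : G.degree x ≤ (edgeCut G S).card := by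
  have hpos : 0 < S.card := card_pos.2 ⟨x, hx⟩
  have hinj : Function.Injective fun w : V => (x, w) := Prod.mk_right_injective x
  obtain h1 | h2 : S.card = 1 ∨ S.card = 2 := by omega
  · obtain ⟨x', rfl⟩ := card_eq_one.1 h1
    obtain rfl := mem_singleton.1 hx
    rw [← G.card_neighborFinset_eq_degree, ← card_image_of_injective _ hinj]
    refine card_le_card fun p hp => ?_
    obtain ⟨w, hw, rfl⟩ := mem_image.1 hp
    rw [SimpleGraph.mem_neighborFinset] at hw
    exact mem_edgeCut.2 ⟨by simp, by simpa using hw.ne', hw⟩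
  · obtain ⟨z, hz⟩ := card_eq_one.1 ((card_erase_of_mem hx).trans (by omega : _ = 1))
    have hzx : z ≠ x ∧ z ∈ S := mem_erase.1 (hz ▸ mem_singleton_self z)
    have hmem : ∀ w, w ≠ x → w ≠ z → w ∉ S := fun w h h' hw =>
      h' (mem_singleton.1 (hz ▸ mem_erase.2 ⟨h, hw⟩))
    obtain ⟨t, ht⟩ : ((G.neighborFinset z).erase x).Nonempty := by
      rw [← card_pos]
      have := pred_card_le_card_erase (s := G.neighborFinset z) (a := x)
      have := hdeg z
      rw [← G.card_neighborFinset_eq_degree] at this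
      omega
    rw [mem_erase, SimpleGraph.mem_neighborFinset] at ht
    have hsub : insert (z, t) (((G.neighborFinset x).erase z).image fun w => (x, w)) ⊆
        edgeCut G S := by
      intro p hp
      rcases mem_insert.1 hp with rfl | hp
      · exact mem_edgeCut.2 ⟨hzx.2, hmem _ ht.1 ht.2.ne', ht.2⟩
      · obtain ⟨w, hw, rfl⟩ := mem_image.1 hp
        rw [mem_erase, SimpleGraph.mem_neighborFinset] at hw
        exact mem_edgeCut.2 ⟨hx, hmem _ hw.2.ne' hw.1, hw.2⟩
    have h3 := card_le_card hsub
    rw [card_insert_of_notMem (by simp [hzx.1.symm]), card_image_of_injective _ hinj] at h3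
    have := pred_card_le_card_erase (s := G.neighborFinset x) (a := z)
    rw [← G.card_neighborFinset_eq_degree]
    omega

open Classical in
/-- Minimum degree two together with large nontrivial edge cuts gives strong Menger edge
connectivity. -/
theorem stronglyMengerEdgeConnected_of_cuts [Nonempty V] {d : ℕ} (hdeg : ∀ v, 2 ≤ G.degree v)
    (hd : ∀ v, G.degree v ≤ d)
    (hcut : ∀ S : Finset V, 3 ≤ S.card → 3 ≤ Sᶜ.card → d ≤ (edgeCut G S).card) :
    StronglyMengerEdgeConnected G := by
  have key : ∀ x y : V, x ≠ y →
      HasEdgeDisjointPaths G x y (min (G.degree x) (G.degree y)) := by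
    intro x y _
    refine hasEdgeDisjointPaths_of_le_card_edgeCut fun S hx hy => ?_
    rcases Nat.lt_or_ge S.card 3 with h | h
    · exact (min_le_left _ _).trans (degree_le_card_edgeCut_of_card_le_two hdeg hx (by omega))
    rcases Nat.lt_or_ge Sᶜ.card 3 with h' | h'
    · rw [← card_edgeCut_compl]
      exact (min_le_right _ _).trans
        (degree_le_card_edgeCut_of_card_le_two hdeg (mem_compl.2 hy) (by omega))
    · exact (min_le_left _ _).trans ((hd x).trans (hcut S h h'))
  refine ⟨⟨fun x y => ?_⟩, key⟩
  by_cases hxy : x = y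
  · exact hxy ▸ .rfl
  · obtain ⟨p, -⟩ := key x y hxy
    have h0 : 0 < min (G.degree x) (G.degree y) := by
      have := hdeg x
      have := hdeg y
      omega
    exact ⟨(p ⟨0, h0⟩).1⟩

open Classical in
/-- In a `d`-regular graph with a triangle one can delete `2d - 5` edges, keeping the minimum
degree at least two, and destroy strong Menger edge connectivity. -/
theorem exists_fault_set_of_triangle {d : ℕ} (hd : 4 ≤ d) (hreg : ∀ v, G.degree v = d)
    (hV : 2 * d < Fintype.card V) {x z w : V} (hxz : G.Adj x z) (hxw : G.Adj x w)
    (hzw : G.Adj z w) :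
    ∃ T : Finset (Sym2 V), T.card = 2 * d - 5 ∧ IsConditionalFaultSet G T ∧
      ¬ StronglyMengerEdgeConnected (G.deleteEdges (T : Set (Sym2 V))) := by
  have hinj : ∀ a : V, Function.Injective fun b => s(a, b) := fun _ _ _ h => Sym2.congr_right.1 h
  set Nz := ((G.neighborFinset z).erase x).erase w with hNz
  set Nw := ((G.neighborFinset w).erase x).erase z with hNw
  set Nx := ((G.neighborFinset x).erase z).erase w with hNx
  have card_two_erase : ∀ a b c : V, b ≠ c → G.Adj a b → G.Adj a c →
      (((G.neighborFinset a).erase b).erase c).card = d - 2 := by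
    intro a b c hbc hb hc
    rw [card_erase_of_mem (by simp [hbc.symm, hc]), card_erase_of_mem (by simp [hb]),
      G.card_neighborFinset_eq_degree, hreg]
    omega
  have mNz : ∀ b, b ∈ Nz ↔ b ≠ w ∧ b ≠ x ∧ G.Adj z b := by simp [hNz]
  have mNw : ∀ b, b ∈ Nw ↔ b ≠ z ∧ b ≠ x ∧ G.Adj w b := by simp [hNw]
  have mNx : ∀ b, b ∈ Nx ↔ b ≠ w ∧ b ≠ z ∧ G.Adj x b := by simp [hNx]
  -- All `2(d - 2)` edges leaving the triangle at `z` or `w`; `T` will omit just one of them.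
  set T₀ := (Nz.image fun b => s(z, b)) ∪ (Nw.image fun b => s(w, b)) with hT₀
  have hT₀c : T₀.card = 2 * d - 4 := by
    rw [hT₀, card_union_of_disjoint, card_image_of_injective _ (hinj _),
      card_image_of_injective _ (hinj _), card_two_erase z x w hxw.ne hxz.symm hzw,
      card_two_erase w x z hxz.ne hxw.symm hzw.symm]
    · omega
    · rw [disjoint_left]
      intro e he he'
      obtain ⟨b, hb, rfl⟩ := mem_image.1 he
      obtain ⟨c, hc, h⟩ := mem_image.1 he'
      rw [mNz] at hb
      rcases Sym2.eq_iff.1 h with ⟨h1, -⟩ | ⟨h1, -⟩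
      · exact hzw.ne h1.symm
      · exact hb.1 h1.symm
  obtain ⟨T, hTT, hT⟩ := exists_subset_card_eq (s := T₀) (n := 2 * d - 5) (by omega)
  have hT₀mem : ∀ a b, s(a, b) ∈ T₀ →
      G.Adj a b ∧ a ≠ x ∧ b ≠ x ∧ (a = z ∧ b ≠ w ∨ a = w ∧ b ≠ z ∨ b = z ∧ a ≠ w ∨
        b = w ∧ a ≠ z) := by
    intro a b h
    rcases mem_union.1 h with h | h <;> obtain ⟨c, hc, h⟩ := mem_image.1 h
    · rw [mNz] at hc
      rcases Sym2.eq_iff.1 h with ⟨rfl, rfl⟩ | ⟨rfl, rfl⟩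
      · exact ⟨hc.2.2, hxz.ne', hc.2.1, .inl ⟨rfl, hc.1⟩⟩
      · exact ⟨hc.2.2.symm, hc.2.1, hxz.ne', .inr (.inr (.inl ⟨rfl, hc.1⟩))⟩
    · rw [mNw] at hc
      rcases Sym2.eq_iff.1 h with ⟨rfl, rfl⟩ | ⟨rfl, rfl⟩
      · exact ⟨hc.2.2, hxw.ne', hc.2.1, .inr (.inl ⟨rfl, hc.1⟩)⟩
      · exact ⟨hc.2.2.symm, hc.2.1, hxw.ne', .inr (.inr (.inr ⟨rfl, hc.1⟩))⟩
  set H := G.deleteEdges (T : Set (Sym2 V)) with hH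
  have hHadj : ∀ a b, H.Adj a b ↔ G.Adj a b ∧ s(a, b) ∉ T := by simp [hH]
  have keep : ∀ a b, G.Adj a b → s(a, b) ∉ T₀ → H.Adj a b := fun a b h h' =>
    (hHadj a b).2 ⟨h, fun h'' => h' (hTT h'')⟩
  have kxz : H.Adj x z := keep _ _ hxz fun h => (hT₀mem _ _ h).2.1 rfl
  have kxw : H.Adj x w := keep _ _ hxw fun h => (hT₀mem _ _ h).2.1 rfl
  have kzw : H.Adj z w := keep _ _ hzw fun h => by
    obtain ⟨-, -, -, h⟩ := hT₀mem _ _ h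
    have := hzw.ne
    tauto
  have two_le : ∀ a b c, b ≠ c → H.Adj a b → H.Adj a c → 2 ≤ H.degree a := by
    intro a b c hbc hb hc
    rw [← H.card_neighborFinset_eq_degree, ← card_pair hbc]
    refine card_le_card fun t ht => ?_
    rcases mem_insert.1 ht with rfl | ht
    · simpa using hb
    · rw [mem_singleton.1 ht]; simpa using hc
  have hdeg : ∀ a, 2 ≤ H.degree a := by
    intro a
    by_cases hax : a = x
    · subst hax; exact two_le _ z w hzw.ne kxz kxw
    by_cases haz : a = z
    · subst haz; exact two_le _ x w hxw.ne kxz.symm kzw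
    by_cases haw : a = w
    · subst haw; exact two_le _ x z hxz.ne kxw.symm kzw.symm
    -- A vertex off the triangle loses at most its edges to `z` and `w`, keeping degree at least `d
    -- - 2 ≥ 2`.
    have hsub : ((G.neighborFinset a).erase z).erase w ⊆ H.neighborFinset a := by
      intro b hb
      simp only [mem_erase, SimpleGraph.mem_neighborFinset] at hb ⊢
      refine keep _ _ hb.2.2 fun h => ?_
      obtain ⟨-, -, -, h⟩ := hT₀mem _ _ h
      tauto
    have h1 := card_le_card hsub
    have h2 := pred_card_le_card_erase (s := (G.neighborFinset a).erase z) (a := w)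
    have h3 := pred_card_le_card_erase (s := G.neighborFinset a) (a := z)
    rw [G.card_neighborFinset_eq_degree, hreg] at h3
    rw [← H.card_neighborFinset_eq_degree]
    omega
  have full : ∀ a, (∀ b, s(a, b) ∉ T₀) → H.degree a = d := by
    intro a ha
    rw [← hreg a, ← H.card_neighborFinset_eq_degree, ← G.card_neighborFinset_eq_degree]
    congr 1
    ext b
    rw [SimpleGraph.mem_neighborFinset, SimpleGraph.mem_neighborFinset]
    exact ⟨fun h => ((hHadj a b).1 h).1, fun h => keep a b h (ha b)⟩
  have hxd : H.degree x = d := full x fun b h => (hT₀mem _ _ h).2.1 rfl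
  -- A target adjacent to neither `z` nor `w` keeps full degree `d`, so `d` paths from `x` would be
  -- required.
  obtain ⟨y, hy⟩ : ∃ y, y ∉ G.neighborFinset z ∪ G.neighborFinset w := by
    by_contra! h
    have h1 := card_union_le (G.neighborFinset z) (G.neighborFinset w)
    rw [eq_univ_iff_forall.2 h, card_univ, G.card_neighborFinset_eq_degree,
      G.card_neighborFinset_eq_degree, hreg, hreg] at h1
    omega
  simp only [mem_union, SimpleGraph.mem_neighborFinset, not_or] at hy
  have hyx : y ≠ x := fun h => hy.1 (h ▸ hxz.symm)
  have hyz : y ≠ z := fun h => hy.2 (h ▸ hzw.symm)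
  have hyw : y ≠ w := fun h => hy.1 (h ▸ hzw)
  have hyd : H.degree y = d := full y fun b h => by
    obtain ⟨h1, -, -, h⟩ := hT₀mem _ _ h
    rcases h with h | h | h | h
    · exact hyz h.1
    · exact hyw h.1
    · exact hy.1 (h.1 ▸ h1.symm)
    · exact hy.2 (h.1 ▸ h1.symm)
  refine ⟨T, hT, ⟨fun e he => ?_, ?_⟩, fun h => ?_⟩
  · induction e with
    | _ a b => exact (hT₀mem a b (hTT he)).1
  · have : Nonempty V := ⟨x⟩
    exact SimpleGraph.le_minDegree_of_forall_le_degree _ _ hdeg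
  · have hp := h.2 x y hyx.symm
    have hp' : HasEdgeDisjointPaths H x y d := by
      have : min (H.degree x) (H.degree y) = d := by rw [hxd, hyd, min_self]
      rw [← this]
      convert hp
    -- The surviving boundary of the triangle has at most `(d - 2) + 1 < d` edges.
    have hle := hp'.le_card (S := {x, z, w}) (C := (Nx.image fun b => s(x, b)) ∪ (T₀ \ T))
      (by simp) (by simp [hyx, hyz, hyw]) (by
        intro a ha b hb hab
        rw [hHadj] at hab
        simp only [Set.mem_insert_iff, Set.mem_singleton_iff, not_or] at ha hb
        rcases ha with rfl | rfl | rfl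
        · exact mem_union_left _
            (mem_image.2 ⟨b, (mNx b).2 ⟨hb.2.2, hb.2.1, hab.1⟩, rfl⟩)
        · refine mem_union_right _ (mem_sdiff.2 ⟨mem_union_left _ ?_, hab.2⟩)
          exact mem_image.2 ⟨b, (mNz b).2 ⟨hb.2.2, hb.1, hab.1⟩, rfl⟩
        · refine mem_union_right _ (mem_sdiff.2 ⟨mem_union_right _ ?_, hab.2⟩)
          exact mem_image.2 ⟨b, (mNw b).2 ⟨hb.2.1, hb.1, hab.1⟩, rfl⟩)
    have h1 := card_union_le (Nx.image fun b => s(x, b)) (T₀ \ T)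
    rw [card_image_of_injective _ (hinj _), card_two_erase x z w hzw.ne hxz hxw,
      card_sdiff_of_subset hTT] at h1
    omega

end MengerCriteria

/-! ### The main theorem -/

open Finset in
theorem theorem4p2 (n : ℕ) (hn : 4 ≤ n) {V : Type u} (Q : SimpleGraph V) [Fintype Q.edgeSet]
    (hQ : IsHypercubeLike n Q) :
    IsConditionalEdgeFaultTolerantSMEC (4 * n - 10) Q.lineGraph ∧
    (∃ T : Finset (Sym2 Q.edgeSet), T.card = 4 * n - 9 ∧ IsConditionalFaultSet Q.lineGraph T ∧
      ¬ StronglyMengerEdgeConnected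
        (Q.lineGraph.deleteEdges (T : Set (Sym2 Q.edgeSet)))) ∧
    ∀ k : ℕ, 4 * n - 10 < k → ¬ IsConditionalEdgeFaultTolerantSMEC k Q.lineGraph := by
  classical
  obtain ⟨hfin, hcardV⟩ := hQ.finite_and_card
  have := Fintype.ofFinite V
  have hreg := hQ.ncard_neighborSet
  have hinc : ∀ v, incidenceCount (univ : Finset Q.edgeSet) v = n := fun v => by
    have := incidenceCount_add_compl (univ : Finset Q.edgeSet) v
    rw [hreg, compl_univ] at this
    simpa [incidenceCount] using this
  -- A crude bound from `2 ^ n ≥ 16`; it exceeds twice the line graph degree, as the triangle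
  -- construction needs.
  have hcardE : 8 * n ≤ Fintype.card Q.edgeSet := by
    have h1 := sum_incidenceCount (univ : Finset Q.edgeSet)
    rw [sum_congr rfl fun v _ => hinc v, sum_const, smul_eq_mul, card_univ, card_univ,
      ← Nat.card_eq_fintype_card, hcardV] at h1
    have h2 : 2 ^ 4 * n ≤ 2 ^ n * n := Nat.mul_le_mul_right _ (Nat.pow_le_pow_right (by omega) hn)
    omega
  have hLdeg : ∀ e, Q.lineGraph.degree e = 2 * n - 2 := fun e => by
    rw [degree_eq_card_filter, card_filter_lineGraph_adj hreg]
  have hsharp : ∃ T : Finset (Sym2 Q.edgeSet), T.card = 4 * n - 9 ∧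
      IsConditionalFaultSet Q.lineGraph T ∧
      ¬ StronglyMengerEdgeConnected (Q.lineGraph.deleteEdges (T : Set (Sym2 Q.edgeSet))) := by
    have : Nonempty V := by
      rw [← Finite.card_pos_iff, hcardV]
      exact Nat.two_pow_pos n
    obtain ⟨v⟩ := this
    obtain ⟨x, hx, z, hz, w, hw, hxz, hxw, hzw⟩ := two_lt_card.1
      (show 2 < ((univ : Finset Q.edgeSet).filter fun e => v ∈ e.1).card by
        have := hinc v
        rw [incidenceCount] at this
        convert (show 2 < n by omega))
    simp only [mem_filter, mem_univ, true_and] at hx hz hw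
    obtain ⟨T, hT, hT'⟩ := exists_fault_set_of_triangle (G := Q.lineGraph) (d := 2 * n - 2)
      (by omega) (fun e => by convert hLdeg e) (by omega)
      (lineGraph_adj_iff.2 ⟨hxz, v, hx, hz⟩) (lineGraph_adj_iff.2 ⟨hxw, v, hx, hw⟩)
      (lineGraph_adj_iff.2 ⟨hzw, v, hz, hw⟩)
    exact ⟨T, by omega, hT'⟩
  refine ⟨fun T hT hTc => ?_, hsharp, fun k hk h => ?_⟩
  · have : Nonempty Q.edgeSet := Fintype.card_pos_iff.1 (by omega)
    refine stronglyMengerEdgeConnected_of_cuts (d := 2 * n - 2)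
      (fun e => hT.two_le_degree e) (fun e => ?_)
      fun S hS hS' => ?_
    · rw [← hLdeg e]
      convert SimpleGraph.degree_le_of_le (SimpleGraph.deleteEdges_le _)
    · have h1 := hQ.le_card_edgeCut_lineGraph hn hS (by convert hS')
      have h2 := card_edgeCut_le_deleteEdges (G := Q.lineGraph) S T
      omega
  · obtain ⟨T, hTc, hT, hT'⟩ := hsharp
    exact hT' (h T hT (by omega))
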